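/- Fix sets $\mathsf{N_C}$, $\mathsf{N_R}$, $\mathsf{N_I}$ of concept, role and individual names and a set $\mathcal A$ of agents. $\mathcal{EL}$ concepts are given by $C,D ::= \top \mid A \mid \exists r.C \mid C\sqcap D$; $\mathcal{EL}$ axioms are the expressions $C\sqsubseteq D$, $A(a)$ and $r(a,b)$; $\mathcal{EL}$ formulas are built from $\mathcal{EL}$ axioms with $\neg$ and $\wedge$. $\mathcal{EL}(\mathcal K)$ axioms are given by $\beta ::= \alpha \mid \mathsf K_i\beta$, with $\alpha$ an $\mathcal{EL}$ formula and $i\in\mathcal A$, and $\mathcal{EL}(\mathcal K)$ formulas by $\varphi,\psi ::= \beta\mid\neg\varphi\mid\varphi\wedge\psi$. An $\mathcal{EL}$ interpretation $\mathcal I$ has a non-empty domain $\Delta^{\mathcal I}$ and interprets concept names as subsets of it, role names as binary relations on it and individual names as elements of it, with the usual semantics ($\top$ is the domain, $\sqcap$ is intersection, $d\in(\exists r.C)^{\mathcal I}$ iff $(d,e)\in r^{\mathcal I}$ for some $e\in C^{\mathcal I}$; $\mathcal I\models C\sqsubseteq D$ iff $C^{\mathcal I}\subseteq D^{\mathcal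 I}$, $\mathcal I\models A(a)$ iff $a^{\mathcal I}\in A^{\mathcal I}$, $\mathcal I\models r(a,b)$ iff $(a^{\mathcal I},b^{\mathcal I})\in r^{\mathcal I}$). An $\mathcal{EL}(\mathcal K)$ interpretation $\mathfrak I=(\mathcal W,\{\mathcal R_i\}_{i\in\mathcal A})$ consists of a set $\mathcal W$ of $\mathcal{EL}$ interpretations (worlds) and an equivalence relation $\mathcal R_i$ on $\mathcal W$ for each agent $i$. At $\mathcal I\in\mathcal W$, an $\mathcal{EL}$ formula holds iff $\mathcal I$ satisfies it, $\mathsf K_i\beta$ holds iff $\beta$ holds at every $\mathcal J\in\mathcal W$ with $(\mathcal I,\mathcal J)\in\mathcal R_i$, and $\neg,\wedge$ are as usual; $\varphi$ is satisfiable if $\mathfrak I,\mathcal I\models\varphi$ for some $\mathfrak I$ and some world $\mathcal I$ of it. The size $|\varphi|$ is the number of symbols of $\varphi$, each name counting as one symbol. The size of an $\mathcal{EL}$ interpretation, relative to $\varphi$, is the length of the listing of its domain and of its interpretation of the names that occur in $\varphi$ (names and domain elements have length 1); the size of an $\mathcal{EL}(\mathcal K)$ interpretation, relative to $\varphi$,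 is the sum of the sizes of its worlds plus the length of the listing of the relations $\mathcal R_i$ of the agents $i$ that occur in $\varphi$, with each world in each pair written out in full. Then $\mathcal{EL}(\mathcal K)$ has the polynomial size model property: there is a polynomial $p$ such that for every satisfiable $\mathcal{EL}(\mathcal K)$ formula $\varphi$ there are an $\mathcal{EL}(\mathcal K)$ interpretation $\mathfrak I$, with finitely many worlds each of which has a finite domain, and a world $\mathcal I$ of $\mathfrak I$ such that $\mathfrak I,\mathcal I\models\varphi$ and the size of $\mathfrak I$ relative to $\varphi$ is at most $p(|\varphi|)$. -/

import Mathlib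

/-! Syntax and semantics of the description logic EL and of its epistemic extension EL(K).
`NC`, `NR`, `NI` are the sets of concept, role and individual names, `Agt` is the set of agents. -/

/-- EL concepts `C, D ::= ⊤ | A | ∃ r.C | C ⊓ D`. -/
inductive ELConcept (NC NR : Type*) where
  | top : ELConcept NC NR
  | name (A : NC) : ELConcept NC NR
  | ex (r : NR) (C : ELConcept NC NR) : ELConcept NC NR
  | inter (C D : ELConcept NC NR) : ELConcept NC NR

/-- EL axioms: inclusions `C ⊑ D` and assertions `A(a)`, `r(a,b)`. -/
inductive ELAxiom (NC NR NI : Type*) where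
  | incl (C D : ELConcept NC NR) : ELAxiom NC NR NI
  | conceptAssertion (A : NC) (a : NI) : ELAxiom NC NR NI
  | roleAssertion (r : NR) (a b : NI) : ELAxiom NC NR NI

/-- EL formulas: Boolean combinations of EL axioms. -/
inductive ELFormula (NC NR NI : Type*) where
  | ax (δ : ELAxiom NC NR NI) : ELFormula NC NR NI
  | neg (α : ELFormula NC NR NI) : ELFormula NC NR NI
  | and (α₁ α₂ : ELFormula NC NR NI) : ELFormula NC NR NI

/-- EL(K) axioms `β ::= α | K_i β` with `α` an EL formula and `i` an agent. -/
inductive ELKAxiom (NC NR NI Agt : Type*) where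
  | el (α : ELFormula NC NR NI) : ELKAxiom NC NR NI Agt
  | know (i : Agt) (β : ELKAxiom NC NR NI Agt) : ELKAxiom NC NR NI Agt

/-- EL(K) formulas `φ ::= β | ¬ φ | φ ∧ ψ` with `β` an EL(K) axiom. -/
inductive ELKFormula (NC NR NI Agt : Type*) where
  | ax (β : ELKAxiom NC NR NI Agt) : ELKFormula NC NR NI Agt
  | neg (φ : ELKFormula NC NR NI Agt) : ELKFormula NC NR NI Agt
  | and (φ ψ : ELKFormula NC NR NI Agt) : ELKFormula NC NR NI Agt

/-! Size of expressions: the number of symbols, punctuation not counted; every name has length 1. -/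

def ELConcept.size {NC NR : Type*} : ELConcept NC NR → ℕ
  | .top => 1
  | .name _ => 1
  | .ex _ C => 2 + C.size
  | .inter C D => 1 + C.size + D.size

def ELAxiom.size {NC NR NI : Type*} : ELAxiom NC NR NI → ℕ
  | .incl C D => 1 + C.size + D.size
  | .conceptAssertion _ _ => 2
  | .roleAssertion _ _ _ => 3

def ELFormula.size {NC NR NI : Type*} : ELFormula NC NR NI → ℕ
  | .ax δ => δ.size
  | .neg α => 1 + α.size
  | .and α₁ α₂ => 1 + α₁.size + α₂.size

def ELKAxiom.size {NC NR NI Agt : Type*} : ELKAxiom NC NR NI Agt → ℕ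
  | .el α => α.size
  | .know _ β => 2 + β.size

def ELKFormula.size {NC NR NI Agt : Type*} : ELKFormula NC NR NI Agt → ℕ
  | .ax β => β.size
  | .neg φ => 1 + φ.size
  | .and φ ψ => 1 + φ.size + ψ.size

/-- A finite set of names: concept names, role names, individual names and agents. -/
structure ELSignature (NC NR NI Agt : Type*) where
  concepts : Finset NC
  roles : Finset NR
  individuals : Finset NI
  agents : Finset Agt

open Classical in
noncomputable def ELSignature.union {NC NR NI Agt : Type*} (S T : ELSignature NC NR NI Agt) :
    ELSignature NC NR NI Agt :=
  ⟨S.concepts ∪ T.concepts, S.roles ∪ T.roles, S.individuals ∪ T.individuals,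
    S.agents ∪ T.agents⟩

/-! The names that occur in an expression. -/

noncomputable def ELConcept.sig {NC NR : Type*} (NI Agt : Type*) :
    ELConcept NC NR → ELSignature NC NR NI Agt
  | .top => ⟨∅, ∅, ∅, ∅⟩
  | .name A => ⟨{A}, ∅, ∅, ∅⟩
  | .ex r C => ELSignature.union ⟨∅, {r}, ∅, ∅⟩ (C.sig NI Agt)
  | .inter C D => (C.sig NI Agt).union (D.sig NI Agt)

open Classical in
noncomputable def ELAxiom.sig {NC NR NI : Type*} (Agt : Type*) :
    ELAxiom NC NR NI → ELSignature NC NR NI Agt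
  | .incl C D => (C.sig NI Agt).union (D.sig NI Agt)
  | .conceptAssertion A a => ⟨{A}, ∅, {a}, ∅⟩
  | .roleAssertion r a b => ⟨∅, {r}, {a, b}, ∅⟩

noncomputable def ELFormula.sig {NC NR NI : Type*} (Agt : Type*) :
    ELFormula NC NR NI → ELSignature NC NR NI Agt
  | .ax δ => δ.sig Agt
  | .neg α => α.sig Agt
  | .and α₁ α₂ => (α₁.sig Agt).union (α₂.sig Agt)

noncomputable def ELKAxiom.sig {NC NR NI Agt : Type*} :
    ELKAxiom NC NR NI Agt → ELSignature NC NR NI Agt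
  | .el α => α.sig Agt
  | .know i β => ELSignature.union ⟨∅, ∅, ∅, {i}⟩ β.sig

noncomputable def ELKFormula.sig {NC NR NI Agt : Type*} :
    ELKFormula NC NR NI Agt → ELSignature NC NR NI Agt
  | .ax β => β.sig
  | .neg φ => φ.sig
  | .and φ ψ => φ.sig.union ψ.sig

/-! Semantics. -/

universe u v w x y z

/-- An EL interpretation over a non-empty domain. -/
structure ELInterp (NC : Type w) (NR : Type x) (NI : Type y) where
  Dom : Type u
  nonempty : Nonempty Dom
  concept : NC → Set Dom
  role : NR → Set (Dom × Dom)
  individual : NI → Dom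

/-- The extension of a complex concept. -/
def ELInterp.ext {NC : Type w} {NR : Type x} {NI : Type y} (I : ELInterp.{u} NC NR NI) :
    ELConcept NC NR → Set I.Dom
  | .top => Set.univ
  | .name A => I.concept A
  | .ex r C => {d | ∃ e ∈ I.ext C, (d, e) ∈ I.role r}
  | .inter C D => I.ext C ∩ I.ext D

def ELInterp.SatAxiom {NC : Type w} {NR : Type x} {NI : Type y} (I : ELInterp.{u} NC NR NI) :
    ELAxiom NC NR NI → Prop
  | .incl C D => I.ext C ⊆ I.ext D
  | .conceptAssertion A a => I.individual a ∈ I.concept A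
  | .roleAssertion r a b => (I.individual a, I.individual b) ∈ I.role r

def ELInterp.Sat {NC : Type w} {NR : Type x} {NI : Type y} (I : ELInterp.{u} NC NR NI) :
    ELFormula NC NR NI → Prop
  | .ax δ => I.SatAxiom δ
  | .neg α => ¬ I.Sat α
  | .and α₁ α₂ => I.Sat α₁ ∧ I.Sat α₂

/-- An EL(K) interpretation: a set of EL interpretations (the worlds) with an equivalence relation
on it for each agent. -/
structure ELKInterp (NC : Type w) (NR : Type x) (NI : Type y) (Agt : Type z) where
  W : Set (ELInterp.{u} NC NR NI)
  R : Agt → Setoid W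

def ELKInterp.SatAxiom {NC : Type w} {NR : Type x} {NI : Type y} {Agt : Type z}
    (M : ELKInterp.{u} NC NR NI Agt) (I : M.W) : ELKAxiom NC NR NI Agt → Prop
  | .el α => I.1.Sat α
  | .know i β => ∀ J : M.W, M.R i I J → M.SatAxiom J β

/-- Truth of an EL(K) formula in the pointed interpretation `(M, I)`. -/
def ELKInterp.Sat {NC : Type w} {NR : Type x} {NI : Type y} {Agt : Type z}
    (M : ELKInterp.{u} NC NR NI Agt) (I : M.W) : ELKFormula NC NR NI Agt → Prop
  | .ax β => M.SatAxiom I β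
  | .neg φ => ¬ M.Sat I φ
  | .and φ ψ => M.Sat I φ ∧ M.Sat I ψ

/-- `φ` is true in some pointed EL(K) interpretation. -/
def ELKFormula.Satisfiable {NC : Type w} {NR : Type x} {NI : Type y} {Agt : Type z}
    (φ : ELKFormula NC NR NI Agt) : Prop :=
  ∃ (M : ELKInterp.{u} NC NR NI Agt) (I : M.W), M.Sat I φ

/-! Size of interpretations, relative to a finite signature: the length of the listing of the
domain and of the interpretations of the names in the signature. -/

/-- The size of an EL interpretation with finite domain: its domain elements, and for each name of
the signature the name followed by its value; each name and each domain element has length 1. -/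
noncomputable def ELInterp.size {NC : Type w} {NR : Type x} {NI : Type y} {Agt : Type z}
    (I : ELInterp.{u} NC NR NI) (S : ELSignature NC NR NI Agt) : ℕ :=
  Nat.card I.Dom
    + ∑ A ∈ S.concepts, (1 + (I.concept A).ncard)
    + ∑ r ∈ S.roles, (1 + 2 * (I.role r).ncard)
    + ∑ _a ∈ S.individuals, 2

/-- Finitely many worlds, each with a finite domain. -/
def ELKInterp.IsFinite {NC : Type w} {NR : Type x} {NI : Type y} {Agt : Type z}
    (M : ELKInterp.{u} NC NR NI Agt) : Prop :=
  M.W.Finite ∧ ∀ I ∈ M.W, Finite I.Dom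

/-- The size of a finite EL(K) interpretation: the listing of its worlds and, for each agent of the
signature, the agent followed by the list of the pairs of worlds in its accessibility relation, in
which the two worlds are written out in full. -/
noncomputable def ELKInterp.size {NC : Type w} {NR : Type x} {NI : Type y} {Agt : Type z}
    (M : ELKInterp.{u} NC NR NI Agt) (S : ELSignature NC NR NI Agt) : ℕ :=
  (∑ᶠ I : M.W, I.1.size S)
    + ∑ i ∈ S.agents,
        (1 + ∑ᶠ p ∈ {p : M.W × M.W | M.R i p.1 p.2}, (p.1.1.size S + p.2.1.size S))

/-! A model is shrunk in two independent ways.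

Few worlds: below the Boolean level, every `K` axiom is a chain `K_i … K_j α` with `α` an EL
formula. A true chain stays true when worlds are dropped; a false one is refuted by a single path of
worlds, no longer than the chain. So linearly many worlds suffice (`ELKFormula.exists_witnesses`).

Small worlds: a world `I` is replaced by finitely many sets of its elements: the extensions of the
subconcepts, the singletons of the named individuals, and `∅`. With `s` in a concept name when `s`
is included in its extension, the same criterion holds for every relevant concept, since EL concepts
have neither negation nor disjunction (`ELInterp.mem_ext_generated`). Hence the relevant EL formulas
keep their truth values.

Shrunken worlds might coincide, while the worlds form a set and carry the accessibility relations.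
Elements are therefore duplicated so that distinct worlds get domains of distinct sizes. -/

/-! Subconcepts. -/

/-- The subconcepts of a concept. -/
def ELConcept.subconcepts {NC NR : Type*} : ELConcept NC NR → List (ELConcept NC NR)
  | .top => [.top]
  | .name A => [.name A]
  | .ex r C => .ex r C :: C.subconcepts
  | .inter C D => .inter C D :: (C.subconcepts ++ D.subconcepts)

def ELAxiom.subconcepts {NC NR NI : Type*} : ELAxiom NC NR NI → List (ELConcept NC NR)
  | .incl C D => C.subconcepts ++ D.subconcepts
  | .conceptAssertion _ _ => []
  | .roleAssertion _ _ _ => []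

def ELFormula.subconcepts {NC NR NI : Type*} : ELFormula NC NR NI → List (ELConcept NC NR)
  | .ax δ => δ.subconcepts
  | .neg α => α.subconcepts
  | .and α₁ α₂ => α₁.subconcepts ++ α₂.subconcepts

def ELKAxiom.subconcepts {NC NR NI Agt : Type*} :
    ELKAxiom NC NR NI Agt → List (ELConcept NC NR)
  | .el α => α.subconcepts
  | .know _ β => β.subconcepts

def ELKFormula.subconcepts {NC NR NI Agt : Type*} :
    ELKFormula NC NR NI Agt → List (ELConcept NC NR)
  | .ax β => β.subconcepts
  | .neg φ => φ.subconcepts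
  | .and φ ψ => φ.subconcepts ++ ψ.subconcepts

theorem ELConcept.mem_subconcepts_self {NC NR : Type*} (C : ELConcept NC NR) :
    C ∈ C.subconcepts := by
  cases C <;> simp [ELConcept.subconcepts]

theorem ELConcept.length_subconcepts_le {NC NR : Type*} (C : ELConcept NC NR) :
    C.subconcepts.length ≤ C.size := by
  induction C with
  | top => simp [subconcepts, size]
  | name A => simp [subconcepts, size]
  | ex r C ih => simp only [subconcepts, size, List.length_cons]; omega
  | inter C D ihC ihD =>
    simp only [subconcepts, size, List.length_cons, List.length_append]; omega

theorem ELFormula.length_subconcepts_le {NC NR NI : Type*} (α : ELFormula NC NR NI) :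
    α.subconcepts.length ≤ α.size := by
  induction α with
  | ax δ =>
    cases δ with
    | incl C D =>
      have hC := C.length_subconcepts_le
      have hD := D.length_subconcepts_le
      simp only [subconcepts, size, ELAxiom.subconcepts, ELAxiom.size, List.length_append]; omega
    | conceptAssertion A a => simp [subconcepts, ELAxiom.subconcepts]
    | roleAssertion r a b => simp [subconcepts, ELAxiom.subconcepts]
  | neg α ih => simp only [subconcepts, size]; omega
  | and α₁ α₂ ih₁ ih₂ => simp only [subconcepts, size, List.length_append]; omega

theorem ELKFormula.length_subconcepts_le {NC NR NI Agt : Type*} (φ : ELKFormula NC NR NI Agt) :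
    φ.subconcepts.length ≤ φ.size := by
  induction φ with
  | ax β =>
    simp only [subconcepts, size]
    induction β with
    | el α => exact α.length_subconcepts_le
    | know i β ih => simp only [ELKAxiom.subconcepts, ELKAxiom.size]; omega
  | neg φ ih => simp only [subconcepts, size]; omega
  | and φ ψ ih₁ ih₂ => simp only [subconcepts, size, List.length_append]; omega

/-! The number of names that occur in an expression. -/

/-- The number of names in a signature. -/
def ELSignature.card {NC NR NI Agt : Type*} (S : ELSignature NC NR NI Agt) : ℕ :=
  S.concepts.card + S.roles.card + S.individuals.card + S.agents.card

theorem ELSignature.card_union_le {NC NR NI Agt : Type*} (S T : ELSignature NC NR NI Agt) :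
    (S.union T).card ≤ S.card + T.card := by
  classical
  have h₁ := Finset.card_union_le S.concepts T.concepts
  have h₂ := Finset.card_union_le S.roles T.roles
  have h₃ := Finset.card_union_le S.individuals T.individuals
  have h₄ := Finset.card_union_le S.agents T.agents
  simp only [card, union]
  omega

theorem ELConcept.card_sig_le {NC NR : Type*} (NI Agt : Type*) (C : ELConcept NC NR) :
    (C.sig NI Agt).card ≤ C.size := by
  induction C with
  | top => simp [sig, size, ELSignature.card]
  | name A => simp [sig, size, ELSignature.card]
  | ex r C ih =>
    refine (ELSignature.card_union_le _ _).trans ?_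
    simp only [size, ELSignature.card, Finset.card_empty, Finset.card_singleton] at ih ⊢
    omega
  | inter C D ihC ihD =>
    refine (ELSignature.card_union_le _ _).trans ?_
    simp only [size]
    omega

theorem ELFormula.card_sig_le {NC NR NI : Type*} (Agt : Type*) (α : ELFormula NC NR NI) :
    (α.sig Agt).card ≤ α.size := by
  induction α with
  | ax δ =>
    cases δ with
    | incl C D =>
      refine (ELSignature.card_union_le _ _).trans ?_
      have hC := C.card_sig_le NI Agt
      have hD := D.card_sig_le NI Agt
      simp only [size, ELAxiom.size]
      omega
    | conceptAssertion A a => simp [sig, size, ELAxiom.sig, ELAxiom.size, ELSignature.card]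
    | roleAssertion r a b =>
      classical
      have := Finset.card_le_two (a := a) (b := b)
      simp only [sig, size, ELAxiom.sig, ELAxiom.size, ELSignature.card, Finset.card_empty,
        Finset.card_singleton]
      convert (by omega : 0 + 1 + ({a, b} : Finset NI).card + 0 ≤ 3)
  | neg α ih => simp only [sig, size]; omega
  | and α₁ α₂ ih₁ ih₂ =>
    refine (ELSignature.card_union_le _ _).trans ?_
    simp only [size]
    omega

theorem ELKAxiom.card_sig_le {NC NR NI Agt : Type*} (β : ELKAxiom NC NR NI Agt) :
    β.sig.card ≤ β.size := by
  induction β with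
  | el α => exact α.card_sig_le Agt
  | know i β ih =>
    refine (ELSignature.card_union_le _ _).trans ?_
    simp only [size, ELSignature.card, Finset.card_empty, Finset.card_singleton] at ih ⊢
    omega

theorem ELKFormula.card_sig_le {NC NR NI Agt : Type*} (φ : ELKFormula NC NR NI Agt) :
    φ.sig.card ≤ φ.size := by
  induction φ with
  | ax β => exact β.card_sig_le
  | neg φ ih => simp only [sig, size]; omega
  | and φ ψ ih₁ ih₂ =>
    refine (ELSignature.card_union_le _ _).trans ?_
    simp only [size]
    omega

/-! EL interpretations generated by families of sets of elements. -/

/-- The interpretation whose elements represent the members of a family `X` of sets of elements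
of `I`: an element belongs to a concept name if all members of its set do, and it is related to
another one if every member of the first set is related to some member of the second. -/
def ELInterp.generated {NC : Type w} {NR : Type x} {NI : Type y} (I : ELInterp.{u} NC NR NI)
    {ι : Type v} (X : ι → Set I.Dom) (c : NI → ι) (h : Nonempty ι) : ELInterp.{v} NC NR NI where
  Dom := ι
  nonempty := h
  concept A := {g | X g ⊆ I.concept A}
  role r := {p | ∀ d ∈ X p.1, ∃ e ∈ X p.2, (d, e) ∈ I.role r}
  individual := c

/-- Intersection commutes with "is included in". For `∃ r.C`, the set `I.ext C` is itself
represented, and this one element serves as successor for every set included in `∃ r.C`. -/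
theorem ELInterp.mem_ext_generated {NC : Type w} {NR : Type x} {NI : Type y}
    (I : ELInterp.{u} NC NR NI) {ι : Type v} (X : ι → Set I.Dom) (c : NI → ι) (h : Nonempty ι)
    (C : ELConcept NC NR) (hC : ∀ D ∈ C.subconcepts, ∃ g, X g = I.ext D) (g : ι) :
    g ∈ (I.generated X c h).ext C ↔ X g ⊆ I.ext C := by
  induction C generalizing g with
  | top => exact iff_of_true (Set.mem_univ g) (Set.subset_univ _)
  | name A => rfl
  | ex r C ih =>
    have hC' : ∀ D ∈ C.subconcepts, ∃ g, X g = I.ext D := fun D hD =>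
      hC D (List.mem_cons_of_mem _ hD)
    constructor
    · rintro ⟨k, hk, hgk⟩ d hd
      obtain ⟨e, he, hde⟩ := hgk d hd
      exact ⟨e, (ih hC' k).1 hk he, hde⟩
    · intro hg
      obtain ⟨k, hk⟩ := hC' C C.mem_subconcepts_self
      refine ⟨k, (ih hC' k).2 hk.subset, fun d hd => ?_⟩
      obtain ⟨e, he, hde⟩ := hg hd
      exact ⟨e, hk.symm.subset he, hde⟩
  | inter C D ihC ihD =>
    simp only [ELConcept.subconcepts, List.mem_cons, List.mem_append] at hC
    exact (and_congr (ihC (fun E hE => hC E (.inr (.inl hE))) g)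
      (ihD (fun E hE => hC E (.inr (.inr hE))) g)).trans Set.subset_inter_iff.symm

theorem ELInterp.satAxiom_generated {NC : Type w} {NR : Type x} {NI : Type y} (Agt : Type z)
    (I : ELInterp.{u} NC NR NI) {ι : Type v} (X : ι → Set I.Dom) (c : NI → ι) (h : Nonempty ι)
    (δ : ELAxiom NC NR NI) (hδ : ∀ D ∈ δ.subconcepts, ∃ g, X g = I.ext D)
    (hc : ∀ a ∈ (δ.sig Agt).individuals, X (c a) = {I.individual a}) :
    (I.generated X c h).SatAxiom δ ↔ I.SatAxiom δ := by
  cases δ with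
  | incl C D =>
    simp only [ELAxiom.subconcepts, List.mem_append] at hδ
    have mC := I.mem_ext_generated X c h C fun E hE => hδ E (.inl hE)
    have mD := I.mem_ext_generated X c h D fun E hE => hδ E (.inr hE)
    constructor
    · intro hCD
      -- The element representing `I.ext C` is the most general instance of `C`: it lies in `D` only
      -- if the inclusion holds in `I`. This is what preserves false inclusions.
      obtain ⟨g, hg⟩ := hδ C (.inl C.mem_subconcepts_self)
      exact hg.symm.subset.trans ((mD g).1 (hCD ((mC g).2 hg.subset)))
    · exact fun hCD g hg => (mD g).2 (((mC g).1 hg).trans hCD)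
  | conceptAssertion A a =>
    change X (c a) ⊆ I.concept A ↔ _
    rw [hc a (by simp [ELAxiom.sig]), Set.singleton_subset_iff]
    rfl
  | roleAssertion r a b =>
    change (∀ d ∈ X (c a), ∃ e ∈ X (c b), (d, e) ∈ I.role r) ↔ _
    rw [hc a (by simp [ELAxiom.sig]), hc b (by simp [ELAxiom.sig])]
    simp [ELInterp.SatAxiom]

theorem ELInterp.sat_generated {NC : Type w} {NR : Type x} {NI : Type y} (Agt : Type z)
    (I : ELInterp.{u} NC NR NI) {ι : Type v} (X : ι → Set I.Dom) (c : NI → ι) (h : Nonempty ι)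
    (α : ELFormula NC NR NI) (hα : ∀ D ∈ α.subconcepts, ∃ g, X g = I.ext D)
    (hc : ∀ a ∈ (α.sig Agt).individuals, X (c a) = {I.individual a}) :
    (I.generated X c h).Sat α ↔ I.Sat α := by
  induction α with
  | ax δ => exact I.satAxiom_generated Agt X c h δ hα hc
  | neg α ih => exact not_congr (ih hα hc)
  | and α₁ α₂ ih₁ ih₂ =>
    simp only [ELFormula.subconcepts, List.mem_append] at hα
    simp only [ELFormula.sig, ELSignature.union, Finset.mem_union] at hc
    exact and_congr (ih₁ (fun D hD => hα D (.inl hD)) fun a ha => hc a (.inl ha))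
      (ih₂ (fun D hD => hα D (.inr hD)) fun a ha => hc a (.inr ha))

/-- Two EL interpretations satisfy the same EL formulas over the given subconcepts and
individual names. -/
def ELInterp.Agree {NC : Type w} {NR : Type x} {NI : Type y} (Agt : Type z)
    (L : List (ELConcept NC NR)) (T : Finset NI)
    (I : ELInterp.{u} NC NR NI) (J : ELInterp.{v} NC NR NI) : Prop :=
  ∀ α : ELFormula NC NR NI, α.subconcepts ⊆ L → (α.sig Agt).individuals ⊆ T →
    (I.Sat α ↔ J.Sat α)

/-- Any sufficiently large domain size can be prescribed, because `generated` takes an indexed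
family, in which a set may occur several times. The main theorem uses this freedom to keep worlds
distinct. -/
theorem ELInterp.exists_agree_of_card {NC : Type w} {NR : Type x} {NI : Type y} (Agt : Type z)
    (I : ELInterp.{u} NC NR NI) (L : List (ELConcept NC NR)) (T : Finset NI) (n : ℕ)
    (hn : L.length + T.card < n) :
    ∃ J : ELInterp.{v} NC NR NI, Finite J.Dom ∧ Nat.card J.Dom = n ∧ J.Agree Agt L T I := by
  classical
  -- `∅` makes `F` nonempty even when `L` and `T` are empty; it accounts for the strict inequality
  -- in `hn`.
  let F : Finset (Set I.Dom) :=
    insert ∅ ((L.map I.ext).toFinset ∪ T.image fun a => {I.individual a})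
  have hF : F.card ≤ n := by
    have h₁ := Finset.card_insert_le (∅ : Set I.Dom)
      ((L.map I.ext).toFinset ∪ T.image fun a => {I.individual a})
    have h₂ := Finset.card_union_le (L.map I.ext).toFinset
      (T.image fun a => ({I.individual a} : Set I.Dom))
    have h₃ := List.toFinset_card_le (L.map I.ext)
    have h₄ := Finset.card_image_le (s := T) (f := fun a => ({I.individual a} : Set I.Dom))
    rw [List.length_map] at h₃
    exact h₁.trans (by omega)
  have hF₀ : Nonempty F := ⟨⟨∅, Finset.mem_insert_self _ _⟩⟩
  obtain ⟨i⟩ : Nonempty (F ↪ ULift.{v} (Fin n)) :=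
    Function.Embedding.nonempty_of_card_le (by simpa using hF)
  -- A left inverse of `i` enumerates all of `F` with exactly `n` indices; surplus indices repeat a
  -- default member.
  let X : ULift.{v} (Fin n) → Set I.Dom := fun k => (Function.invFun i k : F)
  have hX : ∀ s ∈ F, ∃ k, X k = s := fun s hs =>
    ⟨i ⟨s, hs⟩, congrArg Subtype.val (Function.leftInverse_invFun i.injective ⟨s, hs⟩)⟩
  have hne : Nonempty (ULift.{v} (Fin n)) := hF₀.map i
  have hc : ∀ a, ∃ k, a ∈ T → X k = {I.individual a} := fun a => by
    by_cases ha : a ∈ T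
    · obtain ⟨k, hk⟩ := hX {I.individual a} (Finset.mem_insert_of_mem
        (Finset.mem_union_right _ (Finset.mem_image_of_mem _ ha)))
      exact ⟨k, fun _ => hk⟩
    · exact ⟨Classical.choice hne, fun h => absurd h ha⟩
  choose c hc using hc
  refine ⟨I.generated X c hne, inferInstanceAs (Finite (ULift.{v} (Fin n))), ?_,
    fun α hL hT => I.sat_generated Agt X c hne α (fun D hD => ?_) fun a ha => hc a (hT ha)⟩
  · change Nat.card (ULift.{v} (Fin n)) = n
    simp
  · refine hX _ (Finset.mem_insert_of_mem (Finset.mem_union_left _ ?_))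
    rw [List.mem_toFinset]
    exact List.mem_map_of_mem (hL hD)

/-! Selecting finitely many worlds. -/

/-- With accessibility pulled back along `e`, each `K_i` ranges over fewer worlds of `M`; only truth
passes from `M` to `N`, since `e` need not be surjective. -/
theorem ELKAxiom.sat_of_sat_image {NC : Type w} {NR : Type x} {NI : Type y} {Agt : Type z}
    (M : ELKInterp.{u} NC NR NI Agt) (N : ELKInterp.{v} NC NR NI Agt)
    (L : List (ELConcept NC NR)) (T : Finset NI) (e : N.W → M.W)
    (hR : ∀ i J K, N.R i J K ↔ M.R i (e J) (e K)) (hA : ∀ J : N.W, J.1.Agree Agt L T (e J).1)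
    (β : ELKAxiom NC NR NI Agt) (hL : β.subconcepts ⊆ L) (hT : β.sig.individuals ⊆ T) (J : N.W)
    (hJ : M.SatAxiom (e J) β) : N.SatAxiom J β := by
  induction β generalizing J with
  | el α => exact (hA J α hL hT).2 hJ
  | know i β ih =>
    exact fun K hJK => ih hL (fun a ha => hT (by simp [ELKAxiom.sig, ELSignature.union, ha])) K
      (hJ (e K) ((hR i J K).1 hJK))

/-- A false `K_i β` needs one successor refuting `β`, plus the witnesses of `β` there; a true one
needs none. The condition on `N` only asks that its worlds cover `V`, so witness sets can be
enlarged and united freely. -/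
theorem ELKAxiom.exists_witnesses {NC : Type w} {NR : Type x} {NI : Type y} {Agt : Type z}
    (M : ELKInterp.{u} NC NR NI Agt) (L : List (ELConcept NC NR)) (T : Finset NI)
    (β : ELKAxiom NC NR NI Agt) (hL : β.subconcepts ⊆ L) (hT : β.sig.individuals ⊆ T) (I : M.W) :
    ∃ V : Finset M.W, V.card ≤ β.size ∧
      ∀ (N : ELKInterp.{v} NC NR NI Agt) (e : N.W → M.W),
        (∀ i J K, N.R i J K ↔ M.R i (e J) (e K)) → (∀ J : N.W, J.1.Agree Agt L T (e J).1) →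
        (∀ J ∈ V, ∃ K, e K = J) → ∀ J, e J = I → (N.SatAxiom J β ↔ M.SatAxiom I β) := by
  classical
  induction β generalizing I with
  | el α =>
    refine ⟨∅, by simp, fun N e _ hA _ J hJ => ?_⟩
    subst hJ
    exact hA J α hL hT
  | know i β ih =>
    have hT' : β.sig.individuals ⊆ T := fun a ha =>
      hT (by simp [ELKAxiom.sig, ELSignature.union, ha])
    by_cases hI : M.SatAxiom I (.know i β)
    · refine ⟨∅, by simp, fun N e hR hA _ J hJ => iff_of_true ?_ hI⟩
      subst hJ
      exact sat_of_sat_image M N L T e hR hA _ hL hT J hI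
    · have hI' := hI
      simp only [ELKInterp.SatAxiom, not_forall] at hI'
      obtain ⟨K, hIK, hK⟩ := hI'
      obtain ⟨V, hV, hN⟩ := ih hL hT' K
      refine ⟨insert K V, ?_, fun N e hR hA hV' J hJ => iff_of_false (fun hJβ => hK ?_) hI⟩
      · have := Finset.card_insert_le K V
        simp only [ELKAxiom.size]
        omega
      · obtain ⟨K', rfl⟩ := hV' K (Finset.mem_insert_self _ _)
        subst hJ
        exact (hN N e hR hA (fun J hJ => hV' J (Finset.mem_insert_of_mem hJ)) K' rfl).1
          (hJβ K' ((hR i J K').2 hIK))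

theorem ELKFormula.exists_witnesses {NC : Type w} {NR : Type x} {NI : Type y} {Agt : Type z}
    (M : ELKInterp.{u} NC NR NI Agt) (L : List (ELConcept NC NR)) (T : Finset NI)
    (φ : ELKFormula NC NR NI Agt) (hL : φ.subconcepts ⊆ L) (hT : φ.sig.individuals ⊆ T)
    (I : M.W) :
    ∃ V : Finset M.W, V.card ≤ φ.size ∧
      ∀ (N : ELKInterp.{v} NC NR NI Agt) (e : N.W → M.W),
        (∀ i J K, N.R i J K ↔ M.R i (e J) (e K)) → (∀ J : N.W, J.1.Agree Agt L T (e J).1) →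
        (∀ J ∈ V, ∃ K, e K = J) → ∀ J, e J = I → (N.Sat J φ ↔ M.Sat I φ) := by
  classical
  induction φ with
  | ax β => exact β.exists_witnesses M L T hL hT I
  | neg φ ih =>
    obtain ⟨V, hV, h⟩ := ih hL hT
    refine ⟨V, ?_, fun N e hR hA hV' J hJ => not_congr (h N e hR hA hV' J hJ)⟩
    simp only [size]
    omega
  | and φ ψ ih₁ ih₂ =>
    simp only [subconcepts, List.append_subset] at hL
    simp only [sig, ELSignature.union, Finset.union_subset_iff] at hT
    obtain ⟨V₁, hV₁, h₁⟩ := ih₁ hL.1 hT.1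
    obtain ⟨V₂, hV₂, h₂⟩ := ih₂ hL.2 hT.2
    refine ⟨V₁ ∪ V₂, ?_, fun N e hR hA hV' J hJ => and_congr
      (h₁ N e hR hA (fun K hK => hV' K (Finset.mem_union_left _ hK)) J hJ)
      (h₂ N e hR hA (fun K hK => hV' K (Finset.mem_union_right _ hK)) J hJ)⟩
    have := Finset.card_union_le V₁ V₂
    simp only [size]
    omega

/-! Bounds on the size of interpretations. -/

theorem ELInterp.size_le {NC : Type w} {NR : Type x} {NI : Type y} {Agt : Type z}
    (I : ELInterp.{u} NC NR NI) [Finite I.Dom] (S : ELSignature NC NR NI Agt) {d n : ℕ}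
    (hd : Nat.card I.Dom ≤ d) (hS : S.card ≤ n) :
    I.size S ≤ d + n * (1 + d) + n * (1 + 2 * (d * d)) + n * 2 := by
  have hC : ∀ A, 1 + (I.concept A).ncard ≤ 1 + d := fun A =>
    Nat.add_le_add_left ((Set.ncard_le_card _).trans hd) 1
  have hr : ∀ r, 1 + 2 * (I.role r).ncard ≤ 1 + 2 * (d * d) := fun r => by
    have := Set.ncard_le_card (I.role r)
    rw [Nat.card_prod] at this
    have := this.trans (Nat.mul_le_mul hd hd)
    omega
  have h₁ := Finset.sum_le_card_nsmul S.concepts _ _ fun A _ => hC A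
  have h₂ := Finset.sum_le_card_nsmul S.roles _ _ fun r _ => hr r
  simp only [smul_eq_mul] at h₁ h₂
  simp only [ELSignature.card] at hS
  simp only [size, Finset.sum_const, smul_eq_mul]
  gcongr
  · exact h₁.trans (Nat.mul_le_mul_right _ (by omega))
  · exact h₂.trans (Nat.mul_le_mul_right _ (by omega))
  · omega

theorem ELKInterp.size_le {NC : Type w} {NR : Type x} {NI : Type y} {Agt : Type z}
    (M : ELKInterp.{u} NC NR NI Agt) [Finite M.W] (S : ELSignature NC NR NI Agt) {k n s : ℕ}
    (hk : Nat.card M.W ≤ k) (hS : S.card ≤ n) (hs : ∀ I : M.W, I.1.size S ≤ s) :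
    M.size S ≤ k * s + n * (1 + k * k * (s + s)) := by
  classical
  have := Fintype.ofFinite M.W
  have hW : ∑ᶠ I : M.W, I.1.size S ≤ k * s := by
    rw [finsum_eq_sum_of_fintype]
    refine (Finset.sum_le_card_nsmul _ _ s fun I _ => hs I).trans ?_
    rw [Finset.card_univ, ← Nat.card_eq_fintype_card]
    exact Nat.mul_le_mul_right _ hk
  have hR : ∀ i, ∑ᶠ p ∈ {p : M.W × M.W | M.R i p.1 p.2}, (p.1.1.size S + p.2.1.size S) ≤
      k * k * (s + s) := fun i => by
    rw [finsum_mem_eq_finite_toFinset_sum _ (Set.toFinite _)]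
    refine (Finset.sum_le_card_nsmul _ _ (s + s) fun p _ =>
      Nat.add_le_add (hs p.1) (hs p.2)).trans ?_
    refine Nat.mul_le_mul_right _ ((Finset.card_le_univ _).trans ?_)
    rw [← Nat.card_eq_fintype_card, Nat.card_prod]
    exact Nat.mul_le_mul hk hk
  have hA := Finset.sum_le_card_nsmul S.agents _ _ fun i _ => Nat.add_le_add_left (hR i) 1
  simp only [ELSignature.card] at hS
  exact Nat.add_le_add hW (hA.trans (Nat.mul_le_mul_right _ (by omega)))

/-! ### The polynomial size model property. -/

open Polynomial in
theorem mainTheorem7 {NC : Type w} {NR : Type x} {NI : Type y} {Agt : Type z} :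
    ∃ p : Polynomial ℕ, ∀ φ : ELKFormula NC NR NI Agt,
      ELKFormula.Satisfiable.{u} φ →
        ∃ (M : ELKInterp.{v} NC NR NI Agt) (I : M.W),
          M.Sat I φ ∧ M.IsFinite ∧ M.size φ.sig ≤ p.eval φ.size := by
  classical
  -- `d`, `s` and `k` bound the domain of a world, the size of a world and the number of worlds. A
  -- domain has `2 * φ.size + 1 + idx J` elements with `idx J ≤ φ.size`.
  let d : ℕ[X] := 3 * X + 2
  let s : ℕ[X] := d + X * (1 + d) + X * (1 + 2 * (d * d)) + X * 2
  let k : ℕ[X] := X + 1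
  refine ⟨k * s + X * (1 + k * k * (s + s)), fun φ ⟨M, I, hI⟩ => ?_⟩
  obtain ⟨V, hV, hVw⟩ := φ.exists_witnesses M φ.subconcepts φ.sig.individuals
    (List.Subset.refl _) (Finset.Subset.refl _) I
  have hsig := φ.card_sig_le
  have hsub := φ.length_subconcepts_le
  have hU : (insert I V).card ≤ φ.size + 1 :=
    (Finset.card_insert_le I V).trans (Nat.succ_le_succ hV)
  let U := {J // J ∈ insert I V}
  let idx : U ≃ Fin (insert I V).card := (insert I V).equivFin
  -- Subconcepts and individual names number at most `φ.size` each, so `2 * φ.size + 1` elements are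
  -- enough; the extra `idx J` gives each selected world its own domain size.
  have hJ : ∀ J : U, ∃ J' : ELInterp.{v} NC NR NI, Finite J'.Dom ∧
      Nat.card J'.Dom = 2 * φ.size + 1 + idx J ∧
        J'.Agree Agt φ.subconcepts φ.sig.individuals J.1.1 := fun J =>
    J.1.1.exists_agree_of_card Agt _ _ _ (by
      have : φ.sig.individuals.card ≤ φ.sig.card := by simp only [ELSignature.card]; omega
      omega)
  choose f hfin hcard hagree using hJ
  -- The cardinality of the domain of `f J` determines `idx J`, hence `J`.
  have hf : Function.Injective f := fun J K hJK => idx.injective <| Fin.ext <| by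
    have h₁ := hcard J
    have h₂ := hcard K
    rw [hJK] at h₁
    omega
  let e : U ≃ Set.range f := Equiv.ofInjective f hf
  let N : ELKInterp.{v} NC NR NI Agt :=
    ⟨Set.range f, fun i => (M.R i).comap fun J => (e.symm J).1⟩
  have : Finite N.W := inferInstanceAs (Finite (Set.range f))
  have hdom : ∀ J ∈ N.W, Finite J.Dom := by
    rintro _ ⟨J, rfl⟩
    exact hfin J
  refine ⟨N, e ⟨I, Finset.mem_insert_self _ _⟩, ?_, ⟨Set.toFinite _, hdom⟩, ?_⟩
  · refine (hVw N (fun J => (e.symm J).1) (fun i J K => Iff.rfl) (fun J => ?_) (fun J hJ => ?_) _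
      ?_).2 hI
    · obtain ⟨K, rfl⟩ := e.surjective J
      rw [e.symm_apply_apply]
      exact hagree K
    · exact ⟨e ⟨J, Finset.mem_insert_of_mem hJ⟩, by rw [e.symm_apply_apply]⟩
    · exact congrArg Subtype.val (e.symm_apply_apply _)
  · have hN : Nat.card N.W ≤ k.eval φ.size := by
      have : Nat.card N.W = (insert I V).card := by
        rw [← Nat.card_congr e, Nat.card_congr idx, Nat.card_fin]
      rw [this]
      simpa only [k, eval_add, eval_X, eval_one] using hU
    have hs : ∀ J : N.W, J.1.size φ.sig ≤ s.eval φ.size := by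
      rintro ⟨_, J, rfl⟩
      have := hfin J
      have hd : Nat.card (f J).Dom ≤ d.eval φ.size := by
        have := (idx J).2
        simp only [hcard, d, eval_add, eval_mul, eval_X, eval_ofNat]
        omega
      simpa [s] using (f J).size_le φ.sig hd hsig
    simpa using N.size_le φ.sig hN hsig hs
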